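/- **Setting.** Let $(T,d,\mu)$ be a compact metric space with a Borel-regular measure $\mu$ such that: * $\mu$ is doubling with constant $C_\mu>1$: $0<\mu(B(x,2r))<C_\mu\,\mu(B(x,r))<\infty$ for all $x\in T$ and $0<r<\operatorname{diam}T$; * $T$ supports a weak $1$-Poincaré inequality with constants $C_P>0$ and $\lambda_P\ge 1$: all balls have positive finite measure, and for every ball $B$, every locally integrable $u:T\to\mathbb R$ and every upper gradient $\rho$ of $u$, $$\frac1{\mu(B)}\int_B|u-u_B|\,d\mu\le C_P\operatorname{diam}(B)\,\frac1{\mu(\lambda_PB)}\int_{\lambda_PB}\rho\,d\mu,\qquad u_B=\frac1{\mu(B)}\int_Bu\,d\mu,$$ where $\lambda_PB=B(x,\lambda_Pr)$ for $B=B(x,r)$; * $T$ is semilocally simply connected and $\pi_1(T,x)\cong\mathbb Z$ for every $x\in T$. Here a Borel function $\rho:T\to[0,\infty]$ is an upper gradient of a map $u$ from $T$ to a metric space $Y$ if $d_Y(u(\gamma(a)),u(\gamma(b)))\le\int_\gamma\rho\,ds$ for all rectifiable paths $\gamma:[a,b]\to T$. It is a $p$-weak upper gradient if the family $\Gamma$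 of rectifiable paths for which this fails has zero $p$-modulus, that is, $\inf\int_T\sigma^p\,d\mu=0$, where the infimum is over Borel $\sigma:T\to[0,\infty]$ with $\int_\gamma\sigma\,ds\ge1$ for all $\gamma\in\Gamma$. A $p$-integrable $p$-weak upper gradient of $u$ is minimal if it is $\mu$-a.e. at most every other $p$-integrable $p$-weak upper gradient of $u$. Fix $x_0\in T$ and a loop $\alpha$ at $x_0$ whose class generates $\pi_1(T,x_0)$. A loop $\gamma$ at $x$ is a degree $1$ loop if it is loop-homotopic to $c*\alpha*\overline{c}$ for some path $c$ from $x$ to $x_0$, where $\overline c$ is the reverse of $c$. Equip $\mathbb R/\mathbb Z$ with the metric $|[s]-[t]|=\inf_{a\in\mathbb Z}|s+a-t|$. A continuous map $f:T\to\mathbb R/\mathbb Z$ has degree $n\in\mathbb Z$ if for every $x\in T$ and every degree $1$ loop $\gamma$ at $x$ the loop $f\circ\gamma$ is loop-homotopic to $t\mapsto f(x)+n[t]$, $t\in[0,1]$. Assume that there is at least one Lipschitz map $T\to\mathbb R/\mathbb Z$ of degree $1$. For $1<p<\infty$ let $$\operatorname{cap}_pT=\inf_f\int_T\rho_f^{\,p}\,d\mu,$$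 where the infimum is over all Lipschitz maps $f:T\to\mathbb R/\mathbb Z$ of degree $1$ and $\rho_f$ is the minimal $p$-weak upper gradient of $f$. Let $$\mathcal H(A)=\sup_{\delta>0}\ \inf\sum_i\frac{\mu(B_i)}{r_i},$$ the infimum being over countable covers of $A$ by balls $B_i$ of radii $r_i\le\delta$ (the codimension $1$ spherical Hausdorff measure). Let $\Gamma^*$ be the family of all level sets $S=\phi^{-1}([0])$ with $\mathcal H(S)<\infty$, where $\phi:T\to\mathbb R/\mathbb Z$ is continuous of degree $1$. With $p^*=\frac p{p-1}$ let $$\operatorname{mod}_{p^*}T=\inf_\rho\int_T\rho^{p^*}\,d\mu,$$ where the infimum is over all Borel $\rho:T\to[0,\infty]$ with $\int_S\rho\,d\mathcal H\ge1$ for all $S\in\Gamma^*$ (and is $\infty$ if there is no such $\rho$). **Theorem.** There is a constant $C>0$ depending only on $C_\mu$, $C_P$ and $\lambda_P$ (in particular not on $p$) such that for every $T$ as above and every $1<p<\infty$: if $\operatorname{cap}_pT>0$, then $$\frac1C\le(\operatorname{cap}_pT)^{1/p}\,(\operatorname{mod}_{p^*}T)^{1/p^*};$$ and if $\operatorname{cap}_pT=0$,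 then $\operatorname{mod}_{p^*}T=\infty$. -/

import Mathlib

open MeasureTheory Set
open scoped ENNReal NNReal Topology unitInterval

noncomputable section

namespace ToroidalDuality

/-! ### Paths, line integrals, modulus of path families -/

/-- A (compact) path `γ : [a, b] → T`. Only the values on `[a, b]` are used. -/
structure CompactPath (T : Type*) [TopologicalSpace T] where
  a : ℝ
  b : ℝ
  le : a ≤ b
  toFun : ℝ → T
  cont : ContinuousOn toFun (Icc a b)

namespace CompactPath

variable {T : Type*} [MetricSpace T]

/-- The length of the path, i.e. the total variation, possibly `∞`. -/
def length (γ : CompactPath T) : ℝ≥0∞ := eVariationOn γ.toFun (Icc γ.a γ.b)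

/-- A path is rectifiable if it has finite length. -/
def Rectifiable (γ : CompactPath T) : Prop := γ.length ≠ ∞

/-- The integral `∫_γ ρ ds` of `ρ` along the rectifiable path `γ`: the integral of `ρ ∘ γₛ` over
`[0, ℓ(γ)]`, where `γₛ` is the arc length parametrization of `γ`. -/
def lineIntegral (γ : CompactPath T) (ρ : T → ℝ≥0∞) : ℝ≥0∞ :=
  ∫⁻ s in Icc (0 : ℝ) γ.length.toReal,
    ρ (naturalParameterization γ.toFun (Icc γ.a γ.b) γ.a s)

end CompactPath

/-- The path `p`-modulus of a family of (compact) paths. For compact paths, locally rectifiable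
means rectifiable. -/
def pathModulus {T : Type*} [MetricSpace T] [MeasurableSpace T] (μ : Measure T) (p : ℝ)
    (Γ : Set (CompactPath T)) : ℝ≥0∞ :=
  ⨅ (ρ : T → ℝ≥0∞) (_ : Measurable ρ)
    (_ : ∀ γ ∈ Γ, γ.Rectifiable → 1 ≤ γ.lineIntegral ρ), ∫⁻ x, ρ x ^ p ∂μ

/-! ### Upper gradients -/

/-- The upper gradient inequality for the pair `(u, ρ)` on the path `γ`. -/
def UpperGradientIneq {T Y : Type*} [MetricSpace T] [PseudoMetricSpace Y]
    (u : T → Y) (ρ : T → ℝ≥0∞) (γ : CompactPath T) : Prop :=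
  edist (u (γ.toFun γ.a)) (u (γ.toFun γ.b)) ≤ γ.lineIntegral ρ

/-- The Borel function `ρ` is an upper gradient of `u`. -/
def IsUpperGradient {T Y : Type*} [MetricSpace T] [MeasurableSpace T] [PseudoMetricSpace Y]
    (u : T → Y) (ρ : T → ℝ≥0∞) : Prop :=
  Measurable ρ ∧ ∀ γ : CompactPath T, γ.Rectifiable → UpperGradientIneq u ρ γ

/-- The Borel function `ρ` is a `p`-weak upper gradient of `u`: the family of rectifiable paths on
which the upper gradient inequality fails has zero `p`-modulus. -/
def IsWeakUpperGradient {T Y : Type*} [MetricSpace T] [MeasurableSpace T] [PseudoMetricSpace Y]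
    (μ : Measure T) (p : ℝ) (u : T → Y) (ρ : T → ℝ≥0∞) : Prop :=
  Measurable ρ ∧
    pathModulus μ p {γ : CompactPath T | γ.Rectifiable ∧ ¬ UpperGradientIneq u ρ γ} = 0

/-- `ρ` is a minimal `p`-weak upper gradient of `u`. Any two minimal `p`-weak upper gradients
agree `μ`-almost everywhere. -/
def IsMinimalWeakUpperGradient {T Y : Type*} [MetricSpace T] [MeasurableSpace T]
    [PseudoMetricSpace Y] (μ : Measure T) (p : ℝ) (u : T → Y) (ρ : T → ℝ≥0∞) : Prop :=
  IsWeakUpperGradient μ p u ρ ∧ ∫⁻ x, ρ x ^ p ∂μ < ∞ ∧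
    ∀ ρ' : T → ℝ≥0∞, IsWeakUpperGradient μ p u ρ' → ∫⁻ x, ρ' x ^ p ∂μ < ∞ → ρ ≤ᵐ[μ] ρ'

/-! ### Doubling measures and the weak 1-Poincaré inequality -/

/-- `μ` is doubling with constant `Cμ`. -/
def IsDoubling {T : Type*} [MetricSpace T] [MeasurableSpace T] (μ : Measure T) (Cμ : ℝ) : Prop :=
  ∀ (x : T) (r : ℝ), 0 < r → r < Metric.diam (univ : Set T) →
    0 < μ (Metric.ball x (2 * r)) ∧
    μ (Metric.ball x (2 * r)) < ENNReal.ofReal Cμ * μ (Metric.ball x r) ∧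
    ENNReal.ofReal Cμ * μ (Metric.ball x r) < ∞

/-- `(T, d, μ)` supports a weak `1`-Poincaré inequality with constants `CP` and `lam`. -/
def SupportsWeakPoincare {T : Type*} [MetricSpace T] [MeasurableSpace T] (μ : Measure T)
    (CP lam : ℝ) : Prop :=
  (∀ (x : T) (r : ℝ), 0 < r → 0 < μ (Metric.ball x r) ∧ μ (Metric.ball x r) < ∞) ∧
  ∀ (u : T → ℝ) (ρ : T → ℝ≥0∞), LocallyIntegrable u μ → IsUpperGradient u ρ →
    ∀ (x : T) (r : ℝ), 0 < r →
      ⨍⁻ y in Metric.ball x r, ‖u y - ⨍ z in Metric.ball x r, u z ∂μ‖ₑ ∂μ ≤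
        ENNReal.ofReal (CP * Metric.diam (Metric.ball x r)) *
          ⨍⁻ y in Metric.ball x (lam * r), ρ y ∂μ

/-! ### Topology: semilocal simple connectedness, loops and maps of degree one -/

/-- Every point `x` has a neighbourhood `U` such that every loop in `U` based at `x` is
null-homotopic in `T`. -/
def SemilocallySimplyConnected (T : Type*) [TopologicalSpace T] : Prop :=
  ∀ x : T, ∃ U : Set T, IsOpen U ∧ x ∈ U ∧
    ∀ γ : Path x x, range γ ⊆ U → γ.Homotopic (Path.refl x)

/-- The homotopy class of the loop `α` generates the fundamental group. -/
def IsGeneratingLoop {T : Type*} [TopologicalSpace T] {x₀ : T} (α : Path x₀ x₀) : Prop :=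
  ∀ g : FundamentalGroup T x₀,
    g ∈ Subgroup.zpowers (FundamentalGroup.fromPath (Path.Homotopic.Quotient.mk α))

/-- `γ` is a degree 1 loop (with respect to the chosen generating loop `α`): it is loop-homotopic
to `c * α * c⁻¹` for some path `c` from its basepoint to `x₀`. -/
def IsDegreeOneLoop {T : Type*} [TopologicalSpace T] {x₀ : T} (α : Path x₀ x₀) {x : T}
    (γ : Path x x) : Prop :=
  ∃ c : Path x x₀, γ.Homotopic ((c.trans α).trans c.symm)

/-- The loop `t ↦ y + n • [t]` in `ℝ / ℤ`. -/
def circleLoop (y : UnitAddCircle) (n : ℤ) : Path y y where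
  toFun t := y + n • ((t : ℝ) : UnitAddCircle)
  continuous_toFun := by
    have h : Continuous fun t : I => ((t : ℝ) : UnitAddCircle) :=
      (AddCircle.continuous_mk' (1 : ℝ)).comp continuous_subtype_val
    exact continuous_const.add (h.zsmul n)
  source' := by simp
  target' := by simp [AddCircle.coe_period (1 : ℝ)]

/-- The continuous map `f : T → ℝ / ℤ` has degree `n` (with respect to the chosen generating
loop `α`). -/
def HasDegree {T : Type*} [TopologicalSpace T] {x₀ : T} (α : Path x₀ x₀)
    (f : C(T, UnitAddCircle)) (n : ℤ) : Prop :=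
  ∀ (x : T) (γ : Path x x), IsDegreeOneLoop α γ →
    (γ.map f.continuous).Homotopic (circleLoop (f x) n)

/-! ### Codimension 1 spherical Hausdorff measure -/

section Hausdorff

variable {T : Type*} [MetricSpace T] [MeasurableSpace T]

/-- The weight `μ(B) / r` of a set `A` that is a ball `B = B(x, r)` with `0 < r ≤ δ`; it is `∞` if
`A` is no such ball. -/
def ballWeight (μ : Measure T) (δ : ℝ) (A : Set T) : ℝ≥0∞ :=
  ⨅ (x : T) (r : ℝ) (_ : 0 < r) (_ : r ≤ δ) (_ : A = Metric.ball x r),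
    μ (Metric.ball x r) / ENNReal.ofReal r

/-- The outer measure `A ↦ inf ∑ᵢ μ(Bᵢ) / rᵢ`, where the infimum is over countable covers of `A` by
balls with radii `rᵢ ≤ δ`. (In `OuterMeasure.boundedBy` the empty set may be used at no cost, so
finite covers are included.) -/
def codimOnePre (μ : Measure T) (δ : ℝ) : OuterMeasure T :=
  OuterMeasure.boundedBy (ballWeight μ δ)

/-- The codimension 1 spherical Hausdorff outer measure. -/
def codimOneOuter (μ : Measure T) : OuterMeasure T :=
  ⨆ (δ : ℝ) (_ : 0 < δ), codimOnePre μ δ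

theorem ballWeight_anti (μ : Measure T) {δ δ' : ℝ} (h : δ ≤ δ') (A : Set T) :
    ballWeight μ δ' A ≤ ballWeight μ δ A := by
  refine le_iInf fun x => le_iInf fun r => le_iInf fun h0 => le_iInf fun h1 => le_iInf fun h2 => ?_
  exact iInf_le_of_le x <| iInf_le_of_le r <| iInf_le_of_le h0 <| iInf_le_of_le (h1.trans h) <|
    iInf_le_of_le h2 le_rfl

theorem codimOnePre_anti (μ : Measure T) {δ δ' : ℝ} (h : δ ≤ δ') :
    codimOnePre μ δ' ≤ codimOnePre μ δ :=
  OuterMeasure.le_boundedBy.2 fun A =>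
    (OuterMeasure.boundedBy_le A).trans (ballWeight_anti μ h A)

theorem codimOneOuter_apply (μ : Measure T) (A : Set T) :
    codimOneOuter μ A = ⨆ (δ : ℝ) (_ : 0 < δ), codimOnePre μ δ A := by
  simp only [codimOneOuter, OuterMeasure.iSup_apply]

theorem codimOneOuter_isMetric (μ : Measure T) : (codimOneOuter μ).IsMetric := by
  rintro s t ⟨ε, ε0, hε⟩
  obtain ⟨η, η0, hη⟩ : ∃ η : ℝ, 0 < η ∧ ENNReal.ofReal (2 * η) ≤ ε := by
    by_cases htop : ε = ∞
    · exact ⟨1, one_pos, by simp [htop]⟩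
    · have hpos := ENNReal.toReal_pos ε0 htop
      refine ⟨ε.toReal / 2, by positivity, ?_⟩
      rw [mul_div_cancel₀ _ (two_ne_zero), ENNReal.ofReal_toReal htop]
  have key : ∀ δ : ℝ, δ ≤ η →
      codimOnePre μ δ (s ∪ t) = codimOnePre μ δ s + codimOnePre μ δ t := by
    intro δ hδ
    refine OuterMeasure.boundedBy_union_of_top_of_nonempty_inter ?_
    rintro A ⟨x, hxs, hxA⟩ ⟨y, hyt, hyA⟩
    refine iInf_eq_top.2 fun z => iInf_eq_top.2 fun r => iInf_eq_top.2 fun h0 =>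
      iInf_eq_top.2 fun h1 => iInf_eq_top.2 fun h2 => ?_
    exfalso
    subst h2
    have hd : dist x y < 2 * η := by
      have h3 := dist_triangle_right x y z
      have h4 := Metric.mem_ball.1 hxA
      have h5 := Metric.mem_ball.1 hyA
      linarith
    have h6 : edist x y < ENNReal.ofReal (2 * η) := by
      rw [edist_dist]
      exact (ENNReal.ofReal_lt_ofReal_iff (by positivity)).2 hd
    exact absurd (hε x hxs y hyt) (not_le.2 (h6.trans_le hη))
  refine le_antisymm (measure_union_le s t) ?_
  rw [codimOneOuter_apply, codimOneOuter_apply, codimOneOuter_apply]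
  refine ENNReal.biSup_add_biSup_le ⟨1, one_pos⟩ ⟨1, one_pos⟩ ?_
  intro δ hδ δ' hδ'
  have hm : 0 < min η (min δ δ') := lt_min η0 (lt_min hδ hδ')
  have h1 : codimOnePre μ δ s ≤ codimOnePre μ (min η (min δ δ')) s :=
    codimOnePre_anti μ ((min_le_right _ _).trans (min_le_left _ _)) s
  have h2 : codimOnePre μ δ' t ≤ codimOnePre μ (min η (min δ δ')) t :=
    codimOnePre_anti μ ((min_le_right _ _).trans (min_le_right _ _)) t
  refine (add_le_add h1 h2).trans ?_
  rw [← key _ (min_le_left η (min δ δ'))]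
  exact le_iSup₂_of_le (min η (min δ δ')) hm le_rfl

/-- The codimension 1 spherical Hausdorff measure `ℋ` as a Borel measure. -/
def codimOneHausdorff [BorelSpace T] (μ : Measure T) : Measure T :=
  (codimOneOuter μ).toMeasure (codimOneOuter_isMetric μ).le_caratheodory

end Hausdorff

/-! ### Modulus of measures, degree 1 capacity, surface modulus -/

/-- The `p`-modulus of a set of measures; it is `∞` if there are no admissible functions. -/
def modulus {T : Type*} [MeasurableSpace T] (μ : Measure T) (p : ℝ) (M : Set (Measure T)) :
    ℝ≥0∞ :=
  ⨅ (ρ : T → ℝ≥0∞) (_ : Measurable ρ) (_ : ∀ ν ∈ M, 1 ≤ ∫⁻ x, ρ x ∂ν), ∫⁻ x, ρ x ^ p ∂μ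

/-- The degree 1 `p`-capacity: the infimum of `∫ ρ_f ^ p dμ` over Lipschitz maps `f : T → ℝ / ℤ` of
degree 1, where `ρ_f` is the minimal `p`-weak upper gradient of `f`. -/
def capacity {T : Type*} [MetricSpace T] [MeasurableSpace T] (μ : Measure T) {x₀ : T}
    (α : Path x₀ x₀) (p : ℝ) : ℝ≥0∞ :=
  ⨅ (f : C(T, UnitAddCircle)) (_ : ∃ K : ℝ≥0, LipschitzWith K f) (_ : HasDegree α f 1)
    (ρ : T → ℝ≥0∞) (_ : IsMinimalWeakUpperGradient μ p f ρ), ∫⁻ x, ρ x ^ p ∂μ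

/-- The family of level sets `φ⁻¹[0]` of finite `ℋ`-measure, where `φ : T → ℝ / ℤ` is continuous of
degree 1. -/
def levelSets {T : Type*} [MetricSpace T] [MeasurableSpace T] [BorelSpace T] (μ : Measure T)
    {x₀ : T} (α : Path x₀ x₀) : Set (Set T) :=
  {S | ∃ φ : C(T, UnitAddCircle), HasDegree α φ 1 ∧ S = φ ⁻¹' {0} ∧ codimOneHausdorff μ S < ∞}

/-- The surface modulus: the modulus of the restrictions of `ℋ` to the level sets. -/
def surfaceModulus {T : Type*} [MetricSpace T] [MeasurableSpace T] [BorelSpace T] (μ : Measure T)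
    {x₀ : T} (α : Path x₀ x₀) (q : ℝ) : ℝ≥0∞ :=
  modulus μ q {ν | ∃ S ∈ levelSets μ α, ν = (codimOneHausdorff μ).restrict S}

end ToroidalDuality

end

open ToroidalDuality

/-! The engine is a coarea inequality: for a Lipschitz map `f` to the circle with integrable upper
gradient `g`, the upper integral over `t` of `∫ h dℋ` on the fibre of `t` is at most `C ∫ h g dμ`,
with `C` depending only on the doubling and Poincaré constants. If `f` has degree 1, so does every
translate `f - t`, so each fibre of finite `ℋ`-measure belongs to `levelSets`. The case `h = 1`
shows that almost all fibres are of this kind. For admissible `h`, integrating `1 ≤ ∫ h dℋ` over the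
circle, which has length 1, gives `1 ≤ C ∫ h g dμ`. Hölder's inequality and infima over `h` and `f`
finish the proof; `C` never sees `p`.

The coarea inequality rests on two facts. At a Lebesgue point of `g`, the Poincaré inequality
telescoped over shrinking balls bounds the local Lipschitz constant of `f` by a multiple of `g`. A
Vitali cover by balls `B` of radius `r` then bounds the slices: a ball has weight about `μ(B) / r`
and meets only fibres over an arc of length about `r g`, so the radius cancels and `∫ g dμ` remains.

The fibre integrals are not known to be measurable in `t`, and `lintegral` is a lower integral, not
subadditive on such functions. Hence the calculus of measurable majorants, `UpperIntegralLE`. -/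

noncomputable section

namespace ToroidalDuality

open Metric Filter

/-! ### Doubling at all scales -/

/-- The doubling inequality for open balls of all radii. -/
def BallDoubling {T : Type*} [MetricSpace T] [MeasurableSpace T] (μ : Measure T) (K : ℝ≥0) : Prop :=
  ∀ (x : T) (r : ℝ), 0 < r → μ (ball x (2 * r)) ≤ K * μ (ball x r)

section Doubling

variable {T : Type*} [MetricSpace T] [MeasurableSpace T] {μ : Measure T} {K : ℝ≥0}

/-- The hypothesis stops at the diameter. Beyond it, the radius `3/4 * diam` is still allowed while
its double already gives the whole space; a one-point space is trivial because `Cμ > 1`. -/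
theorem IsDoubling.ballDoubling [CompactSpace T] {Cμ : ℝ} (h1 : 1 < Cμ) (h : IsDoubling μ Cμ) :
    BallDoubling μ Cμ.toNNReal := by
  intro x r hr
  change μ (ball x (2 * r)) ≤ ENNReal.ofReal Cμ * μ (ball x r)
  have hdist : ∀ y z : T, dist y z ≤ diam (univ : Set T) := fun y z =>
    dist_le_diam_of_mem isCompact_univ.isBounded (mem_univ _) (mem_univ _)
  rcases lt_or_ge r (diam (univ : Set T)) with hlt | hge
  · exact (h x r hr hlt).2.1.le
  have hone : (1 : ℝ≥0∞) ≤ ENNReal.ofReal Cμ := by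
    rw [← ENNReal.ofReal_one]; exact ENNReal.ofReal_le_ofReal h1.le
  rcases (diam_nonneg (s := (univ : Set T))).eq_or_lt with h0 | hpos
  · have : ball x r = univ := eq_univ_of_forall fun y => by
      rw [mem_ball]; have := hdist y x; linarith
    rw [this]
    exact (measure_mono (subset_univ _)).trans (le_mul_of_one_le_left (zero_le) hone)
  · have hb : ball x (2 * (3 / 4 * diam (univ : Set T))) = univ := eq_univ_of_forall fun y => by
      rw [mem_ball]; have := hdist y x; linarith
    calc μ (ball x (2 * r)) ≤ μ (ball x (2 * (3 / 4 * diam (univ : Set T)))) := by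
          rw [hb]; exact measure_mono (subset_univ _)
      _ ≤ ENNReal.ofReal Cμ * μ (ball x (3 / 4 * diam (univ : Set T))) :=
          (h x _ (by linarith) (by linarith)).2.1.le
      _ ≤ _ := by gcongr; linarith

theorem BallDoubling.four (h : BallDoubling μ K) (x : T) {r : ℝ} (hr : 0 < r) :
    μ (ball x (4 * r)) ≤ K ^ 2 * μ (ball x r) := by
  have h1 := h x (2 * r) (by linarith)
  rw [← mul_assoc] at h1
  norm_num at h1
  refine h1.trans ?_
  rw [pow_two, mul_assoc]
  gcongr
  exact h x r hr

theorem BallDoubling.eight (h : BallDoubling μ K) (x : T) {r : ℝ} (hr : 0 < r) :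
    μ (ball x (8 * r)) ≤ K ^ 3 * μ (ball x r) := by
  have h1 := h x (4 * r) (by linarith)
  rw [← mul_assoc] at h1
  norm_num at h1
  refine h1.trans ?_
  rw [pow_succ', mul_assoc]
  gcongr
  exact h.four x hr

theorem BallDoubling.closedBall_le (h : BallDoubling μ K) (x : T) {r : ℝ} (hr : 0 < r) :
    μ (closedBall x r) ≤ K * μ (ball x r) :=
  (measure_mono (closedBall_subset_ball (by linarith))).trans (h x r hr)

/-- Gives access to the Vitali family behind Lebesgue differentiation. -/
theorem BallDoubling.isUnifLocDoublingMeasure (h : BallDoubling μ K) :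
    IsUnifLocDoublingMeasure μ where
  exists_measure_closedBall_le_mul'' := by
    refine ⟨K ^ 2, ?_⟩
    filter_upwards [self_mem_nhdsWithin] with r hr x
    have hr : 0 < r := hr
    calc μ (closedBall x (2 * r)) ≤ μ (ball x (4 * r)) :=
          measure_mono (closedBall_subset_ball (by linarith))
      _ ≤ K ^ 2 * μ (ball x r) := h.four x hr
      _ ≤ _ := by push_cast; gcongr; exact ball_subset_closedBall

end Doubling

/-! ### Lebesgue points -/

section Lebesgue

variable {T : Type*} [MetricSpace T] [MeasurableSpace T]

/-- A point `x` with `g x < ∞` at which the averages of `g` over closed balls shrinking to `x`, not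
necessarily centred at `x`, converge to `g x`. -/
def IsLebesguePoint (μ : Measure T) (g : T → ℝ≥0∞) (x : T) : Prop :=
  g x ≠ ∞ ∧ ∀ (k : ℕ) (ε : ℝ≥0), 0 < ε → ∃ R : ℝ, 0 < R ∧ ∀ (w : T) (δ : ℝ), 0 < δ → δ < R →
    dist x w ≤ k * δ →
      ∫⁻ y in closedBall w δ, g y ∂μ ≤ (g x + ε) * μ (closedBall w δ) ∧
      g x * μ (closedBall w δ) ≤ ∫⁻ y in closedBall w δ, g y ∂μ + ε * μ (closedBall w δ)

theorem ae_isLebesguePoint [BorelSpace T] [SecondCountableTopology T] {μ : Measure T}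
    [IsFiniteMeasure μ] {K : ℝ≥0} (hK : BallDoubling μ K)
    (hpos : ∀ (x : T) (r : ℝ), 0 < r → 0 < μ (ball x r))
    {g : T → ℝ≥0∞} (hg : Measurable g) (hint : ∫⁻ x, g x ∂μ ≠ ∞) :
    ∀ᵐ x ∂μ, IsLebesguePoint μ g x := by
  have := hK.isUnifLocDoublingMeasure
  have h1 : ∀ᵐ x ∂μ, ∀ k : ℕ,
      Tendsto (fun a => (∫⁻ y in a, g y ∂μ) / μ a)
        ((IsUnifLocDoublingMeasure.vitaliFamily μ (k : ℝ)).filterAt x) (𝓝 (g x)) :=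
    ae_all_iff.2 fun k => VitaliFamily.ae_tendsto_lintegral_div _ hg.aemeasurable hint
  filter_upwards [h1, ae_lt_top hg hint] with x hx hfin
  refine ⟨hfin.ne, fun k ε hε => ?_⟩
  -- A filter on pairs (centre, radius): the radius tends to `0` and the centre stays within `k`
  -- radii of `x`. Unfolding it yields one threshold `R` for all centres.
  let l : Filter (T × ℝ) := comap Prod.snd (𝓝[>] 0) ⊓ 𝓟 {q | dist x q.1 ≤ k * q.2}
  have hl : Tendsto (fun q : T × ℝ => closedBall q.1 q.2) l
      ((IsUnifLocDoublingMeasure.vitaliFamily μ (k : ℝ)).filterAt x) :=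
    IsUnifLocDoublingMeasure.tendsto_closedBall_filterAt μ _ _
      (tendsto_comap.mono_left inf_le_left)
      ((mem_principal_self {q : T × ℝ | dist x q.1 ≤ k * q.2} |> mem_inf_of_right))
  have hε' : (ε : ℝ≥0∞) ≠ 0 := by simpa using hε.ne'
  have h2 := ((hx k).comp hl).eventually (ENNReal.Icc_mem_nhds hfin.ne hε')
  rw [eventually_inf_principal] at h2
  obtain ⟨s, hs, hsub⟩ := mem_comap.1 h2
  obtain ⟨R, hR, hRs⟩ := mem_nhdsGT_iff_exists_Ioo_subset.1 hs
  refine ⟨R, hR, fun w δ hδ hδR hd => ?_⟩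
  have h3 := hsub (show (w, δ) ∈ Prod.snd ⁻¹' s from hRs ⟨hδ, hδR⟩) hd
  have hp : μ (closedBall w δ) ≠ 0 :=
    ((hpos w δ hδ).trans_le (measure_mono ball_subset_closedBall)).ne'
  have hf : μ (closedBall w δ) ≠ ∞ := measure_ne_top _ _
  simp only [Function.comp] at h3
  constructor
  · exact (ENNReal.div_le_iff hp hf).1 h3.2
  · have h4 := (ENNReal.le_div_iff_mul_le (Or.inl hp) (Or.inl hf)).1 h3.1
    rw [ENNReal.sub_mul (fun _ _ => hf)] at h4
    exact tsub_le_iff_right.1 h4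

end Lebesgue

/-! ### Telescoping averages with the Poincaré inequality -/

/-- Telescoping over `k` dyadic scales. -/
theorem abs_average_telescope {T : Type*} [MetricSpace T] [MeasurableSpace T]
    {μ : Measure T} {u : T → ℝ} {x : T} {r D : ℝ} (k : ℕ)
    (h : ∀ i < k, |(⨍ y in ball x (r / 2 ^ (i + 1)), u y ∂μ) - ⨍ y in ball x (r / 2 ^ i), u y ∂μ| ≤
      D * (r / 2 ^ i)) :
    |(⨍ y in ball x (r / 2 ^ k), u y ∂μ) - ⨍ y in ball x r, u y ∂μ| ≤ 2 * D * (r - r / 2 ^ k) := by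
  induction k with
  | zero => simp
  | succ k ih =>
    have h1 := ih fun i hi => h i (by omega)
    have h2 := h k (by omega)
    have h3 : r / 2 ^ (k + 1) = r / 2 ^ k / 2 := by rw [pow_succ, div_div]
    have h4 := abs_sub_le (⨍ y in ball x (r / 2 ^ (k + 1)), u y ∂μ)
      (⨍ y in ball x (r / 2 ^ k), u y ∂μ) (⨍ y in ball x r, u y ∂μ)
    rw [h3] at h4 h2 ⊢
    linarith

theorem enorm_average_sub_le {T : Type*} [MeasurableSpace T] {μ : Measure T} [IsFiniteMeasure μ]
    {u : T → ℝ} (hu : Integrable u μ) {A B : Set T} (hAB : A ⊆ B)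
    {K : ℝ≥0∞} (hA : μ A ≠ 0) (hK : μ B ≤ K * μ A) (c : ℝ) :
    ‖(⨍ z in A, u z ∂μ) - c‖ₑ ≤ K * ⨍⁻ y in B, ‖u y - c‖ₑ ∂μ := by
  have hAt : μ A ≠ ∞ := measure_ne_top _ _
  have hB : μ B ≠ 0 := fun h => hA (measure_mono_null hAB h)
  have hBt : μ B ≠ ∞ := measure_ne_top _ _
  have h1 : (⨍ z in A, u z ∂μ) - c = ⨍ z in A, (u z - c) ∂μ := by
    rw [setAverage_eq, setAverage_eq, integral_sub hu.integrableOn (by simp)]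
    have : (μ.real A) ≠ 0 := by simp [measureReal_def, ENNReal.toReal_eq_zero_iff, hA, hAt]
    simp [mul_sub, this]
  rw [h1, setAverage_eq, enorm_smul, setLAverage_eq]
  have h2 : ‖(μ.real A)⁻¹‖ₑ = (μ A)⁻¹ := by
    rw [Real.enorm_eq_ofReal (by positivity), measureReal_def, ENNReal.ofReal_inv_of_pos
      (ENNReal.toReal_pos hA hAt), ENNReal.ofReal_toReal hAt]
  have h3 : (μ A)⁻¹ ≤ K * (μ B)⁻¹ := by
    rw [← div_eq_mul_inv, ENNReal.le_div_iff_mul_le (Or.inl hB) (Or.inl hBt), mul_comm,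
      ← div_eq_mul_inv]
    exact ENNReal.div_le_of_le_mul hK
  rw [h2, ENNReal.div_eq_inv_mul, ← mul_assoc]
  exact mul_le_mul' h3 ((enorm_integral_le_lintegral_enorm _).trans (lintegral_mono_set hAB))

section Poincare

variable {T : Type*} [MetricSpace T] [CompactSpace T] [MeasurableSpace T] [BorelSpace T]
  {μ : Measure T} [IsFiniteMeasure μ]

/-- If the averages of the upper gradient `g` over a ball are at most `M`, then the averages of `u`
over comparable concentric or nested balls differ by at most a multiple of the radius. -/
theorem SupportsWeakPoincare.dist_average_le {CP lam : ℝ} (hCP : 0 < CP)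
    (hP : SupportsWeakPoincare μ CP lam) {u : T → ℝ} (hu : Continuous u) {g : T → ℝ≥0∞}
    (hg : IsUpperGradient u g) {z w : T} {r s : ℝ} (hr : 0 < r) (hs : 0 < s)
    (hsub : ball w s ⊆ ball z r) {K M : ℝ≥0} (hK : μ (ball z r) ≤ K * μ (ball w s))
    (hM : ⨍⁻ y in ball z (lam * r), g y ∂μ ≤ M) :
    |(⨍ y in ball w s, u y ∂μ) - ⨍ y in ball z r, u y ∂μ| ≤ K * (2 * CP * M) * r := by
  have hui : Integrable u μ := hu.integrable_of_hasCompactSupport (HasCompactSupport.of_compactSpace u)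
  have h1 := enorm_average_sub_le hui hsub (hP.1 w s hs).1.ne' hK (⨍ y in ball z r, u y ∂μ)
  have h2 := hP.2 u g hui.locallyIntegrable hg z r hr
  have h3 : ‖(⨍ y in ball w s, u y ∂μ) - ⨍ y in ball z r, u y ∂μ‖ₑ ≤
      ENNReal.ofReal (K * (2 * CP * M) * r) := by
    refine (h1.trans (mul_le_mul' le_rfl (h2.trans (mul_le_mul' le_rfl hM)))).trans ?_
    have : K * (2 * CP * M) * r = (K : ℝ) * ((CP * (2 * r)) * M) := by ring
    rw [this, ENNReal.ofReal_mul (p := (K : ℝ)) (by positivity), ENNReal.ofReal_coe_nnreal,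
      ENNReal.ofReal_mul (q := (M : ℝ)) (by positivity), ENNReal.ofReal_coe_nnreal]
    gcongr
    exact diam_ball hr.le
  rw [← ofReal_norm] at h3
  rw [← Real.norm_eq_abs]
  exact (ENNReal.ofReal_le_ofReal_iff (by positivity)).1 h3

theorem abs_average_sub_le {u : T → ℝ} (hu : Continuous u) {x : T} {s c : ℝ}
    (hpos : μ (ball x s) ≠ 0) (hc : ∀ y ∈ ball x s, |u y - u x| ≤ c) :
    |(⨍ y in ball x s, u y ∂μ) - u x| ≤ c := by
  have hui : Integrable u μ := hu.integrable_of_hasCompactSupport (HasCompactSupport.of_compactSpace u)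
  have h := (convex_closedBall (u x) c).set_average_mem (μ := μ) (t := ball x s) (f := u)
    isClosed_closedBall hpos (measure_ne_top _ _)
    ((ae_restrict_mem measurableSet_ball).mono fun y hy => by
      rw [mem_closedBall, Real.dist_eq]; exact hc y hy) hui.integrableOn
  rwa [mem_closedBall, Real.dist_eq] at h

end Poincare

/-! ### Pointwise control of a Lipschitz map by its upper gradient -/

section Pointwise

variable {T : Type*} [MetricSpace T] [CompactSpace T] [MeasurableSpace T] [BorelSpace T]
  {μ : Measure T} [IsFiniteMeasure μ]

/-- With `r = dist y x`, go from `u x` to `u y` through averages over the balls `B(x, r/2^k)`, ...,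
`B(x, r)`, `B(x, 2r)`, `B(y, r)`, ..., `B(y, r/2^k)`. The Poincaré inequality pays for each step.
The chain stops after `k` scales, where the Lipschitz constant closes both ends; so `y` need not be
a Lebesgue point, and every ball used lies within `2^k` radii of `x`. -/
theorem SupportsWeakPoincare.abs_sub_le {CP lam : ℝ} (hCP : 0 < CP) (hlam : 1 ≤ lam)
    (hP : SupportsWeakPoincare μ CP lam) {K : ℝ≥0} (hK : BallDoubling μ K) (hK1 : 1 ≤ K)
    {u : T → ℝ} {L : ℝ≥0} (hu : LipschitzWith L u) {g : T → ℝ≥0∞} (hg : IsUpperGradient u g)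
    {x : T} (hx : IsLebesguePoint μ g x) {ε : ℝ≥0} (hε : 0 < ε) :
    ∃ R : ℝ, 0 < R ∧ ∀ y, dist y x < R →
      |u y - u x| ≤ dist y x * (16 * K ^ 3 * CP * ((g x).toNNReal + ε) + ε) := by
  obtain ⟨hfin, hx⟩ := hx
  obtain ⟨k, hk⟩ : ∃ k : ℕ, 2 * (L : ℝ) / 2 ^ k ≤ ε := by
    obtain ⟨k, hk⟩ := exists_nat_gt (2 * (L : ℝ) / ε)
    refine ⟨k, ?_⟩
    have hε' : (0 : ℝ) < ε := hε
    have h2k : (k : ℝ) ≤ 2 ^ k := by exact_mod_cast k.lt_two_pow_self.le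
    rw [div_le_iff₀ (by positivity), mul_comm]
    rw [div_lt_iff₀ hε'] at hk
    nlinarith
  obtain ⟨R, hR, hLeb⟩ := hx (2 ^ k) ε hε
  -- The largest ball on which `g` is averaged has radius `2 * lam * r`, which must stay below `R`.
  refine ⟨R / (2 * lam), by positivity, fun y hy => ?_⟩
  rcases eq_or_ne y x with rfl | hne
  · simp
  set r := dist y x with hr_def
  have hr : 0 < r := dist_pos.2 hne
  have hlam0 : 0 < lam := by linarith
  rw [lt_div_iff₀ (by positivity)] at hy
  -- The factor `K` pays for passing from closed balls (Lebesgue points) to open balls (Poincaré).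
  set M : ℝ≥0 := K * ((g x).toNNReal + ε) with hM_def
  have hMav : ∀ (w : T) (s : ℝ), 0 < s → lam * s < R → dist x w ≤ 2 ^ k * (lam * s) →
      ⨍⁻ z in ball w (lam * s), g z ∂μ ≤ M := by
    intro w s hs hsR hd
    have hls : 0 < lam * s := by positivity
    have h1 := (hLeb w (lam * s) hls hsR (by push_cast; exact hd)).1
    rw [setLAverage_eq]
    refine ENNReal.div_le_of_le_mul ?_
    calc ∫⁻ z in ball w (lam * s), g z ∂μ ≤ ∫⁻ z in closedBall w (lam * s), g z ∂μ :=
          lintegral_mono_set ball_subset_closedBall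
      _ ≤ (g x + ε) * (K * μ (ball w (lam * s))) :=
          h1.trans (mul_le_mul' le_rfl (hK.closedBall_le w hls))
      _ = M * μ (ball w (lam * s)) := by
          rw [hM_def]; push_cast; rw [ENNReal.coe_toNNReal hfin]; ring
  set D : ℝ := K ^ 2 * (2 * CP * M) with hD_def
  have hcont := hu.continuous
  have h2k : (1 : ℝ) ≤ 2 ^ k := one_le_pow₀ (by norm_num)
  have hKK : K ≤ K ^ 2 := by nlinarith
  have hKD : (K : ℝ) * (2 * CP * M) ≤ D := by
    rw [hD_def]; gcongr; exact_mod_cast hKK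
  have htel : ∀ w : T, dist x w ≤ r →
      |(⨍ z in ball w (r / 2 ^ k), u z ∂μ) - ⨍ z in ball w r, u z ∂μ| ≤
        2 * D * (r - r / 2 ^ k) := by
    intro w hw
    refine abs_average_telescope k fun i hi => ?_
    have hi0 : 0 < r / 2 ^ i := by positivity
    have hi1 : r / 2 ^ i ≤ r := div_le_self hr.le (one_le_pow₀ (by norm_num))
    have hhalf : r / 2 ^ i = 2 * (r / 2 ^ (i + 1)) := by rw [pow_succ]; field_simp
    have hi2 : r ≤ 2 ^ k * (r / 2 ^ i) := by
      have : (2 : ℝ) ^ i ≤ 2 ^ k := pow_le_pow_right₀ (by norm_num) hi.le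
      rw [mul_div_assoc', le_div_iff₀ (by positivity), mul_comm]
      gcongr
    refine (hP.dist_average_le hCP hcont hg hi0 (by positivity)
      (ball_subset_ball (by linarith)) ?_ (hMav w _ hi0 ?_ ?_)).trans
      (mul_le_mul_of_nonneg_right hKD hi0.le)
    · rw [hhalf]; exact hK w _ (by positivity)
    · nlinarith
    · nlinarith [mul_nonneg (sub_nonneg.2 hlam) (mul_nonneg (zero_le_one.trans h2k) hi0.le)]
  have hM2 : ⨍⁻ z in ball x (lam * (2 * r)), g z ∂μ ≤ M :=
    hMav x (2 * r) (by positivity) (by nlinarith) (by rw [dist_self]; positivity)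
  have hbig : ∀ w : T, dist x w ≤ r →
      |(⨍ z in ball w r, u z ∂μ) - ⨍ z in ball x (2 * r), u z ∂μ| ≤ D * (2 * r) := by
    intro w hw
    have := hP.dist_average_le hCP hcont hg (by positivity : 0 < 2 * r) hr (z := x) (w := w)
      (K := K ^ 2) (ball_subset_ball' (by rw [dist_comm]; linarith)) ?_ hM2
    · rw [hD_def]; exact_mod_cast this
    · push_cast
      exact (measure_mono (ball_subset_ball' (by linarith))).trans (hK.four w hr)
  have hpt : ∀ w : T, |(⨍ z in ball w (r / 2 ^ k), u z ∂μ) - u w| ≤ L * (r / 2 ^ k) := by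
    intro w
    refine abs_average_sub_le hcont (hP.1 w _ (by positivity)).1.ne' fun z hz => ?_
    rw [← Real.dist_eq]
    exact (hu.dist_le_mul z w).trans (by gcongr; exact (mem_ball.1 hz).le)
  have hxx : dist x x ≤ r := by rw [dist_self]; exact hr.le
  have hxy : dist x y ≤ r := by rw [dist_comm]
  have e1 := abs_le.1 (hpt x)
  have e2 := abs_le.1 (hpt y)
  have e3 := abs_le.1 (htel x hxx)
  have e4 := abs_le.1 (htel y hxy)
  have e5 := abs_le.1 (hbig x hxx)
  have e6 := abs_le.1 (hbig y hxy)
  have hD0 : 0 ≤ D := by positivity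
  have hDr : 0 ≤ D * (r / 2 ^ k) := by positivity
  have h7 : 2 * L * (r / 2 ^ k) ≤ r * ε := by
    calc 2 * L * (r / 2 ^ k) = r * (2 * (L : ℝ) / 2 ^ k) := by ring
      _ ≤ _ := by gcongr
  -- Each telescope costs at most `2 * D * r` and each passage to `B(x, 2r)` costs `2 * D * r`; with
  -- one of each at `x` and at `y`, the total is `8 * D * r`.
  have h8 : (16 : ℝ) * K ^ 3 * CP * ((g x).toNNReal + ε) = 8 * D := by
    rw [hD_def, hM_def]; push_cast; ring
  rw [h8, abs_le]
  constructor <;> linarith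

/-- At a Lebesgue point of an upper gradient of a Lipschitz map, the upper gradient controls the
local Lipschitz constant. -/
theorem SupportsWeakPoincare.dist_le {Y : Type*} [PseudoMetricSpace Y] {CP lam : ℝ}
    (hCP : 0 < CP) (hlam : 1 ≤ lam)
    (hP : SupportsWeakPoincare μ CP lam) {K : ℝ≥0} (hK : BallDoubling μ K) (hK1 : 1 ≤ K)
    {f : T → Y} {L : ℝ≥0} (hf : LipschitzWith L f) {g : T → ℝ≥0∞} (hg : IsUpperGradient f g)
    {x : T} (hx : IsLebesguePoint μ g x) {ε : ℝ≥0} (hε : 0 < ε) :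
    ∃ R : ℝ, 0 < R ∧ ∀ y, dist y x < R →
      dist (f y) (f x) ≤ dist y x * (16 * K ^ 3 * CP * ((g x).toNNReal + ε) + ε) := by
  -- Composing with the distance to `f x` reduces to real values, and being 1-Lipschitz it keeps `g`
  -- as an upper gradient.
  have hd : LipschitzWith 1 fun z : Y => dist z (f x) := LipschitzWith.dist_left (f x)
  have hu : LipschitzWith L fun y => dist (f y) (f x) := by
    have := hd.comp hf
    rwa [one_mul] at this
  have hgu : IsUpperGradient (fun y => dist (f y) (f x)) g := by
    refine ⟨hg.1, fun γ hγ => ?_⟩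
    refine le_trans ?_ (hg.2 γ hγ)
    simpa using hd (f (γ.toFun γ.a)) (f (γ.toFun γ.b))
  obtain ⟨R, hR, h⟩ := hP.abs_sub_le hCP hlam hK hK1 hu hgu hx hε
  refine ⟨R, hR, fun y hy => ?_⟩
  simpa using h y hy

end Pointwise

/-! ### Upper integrals -/

section UpperIntegral

variable {X : Type*} [MeasurableSpace X] {ν : Measure X}

/-- The upper integral of the (possibly nonmeasurable) function `F` is attained by a measurable
majorant and is at most `c`. -/
def UpperIntegralLE (ν : Measure X) (F : X → ℝ≥0∞) (c : ℝ≥0∞) : Prop :=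
  ∃ G : X → ℝ≥0∞, Measurable G ∧ (∀ t, F t ≤ G t) ∧ ∫⁻ t, G t ∂ν ≤ c

theorem UpperIntegralLE.mono {F F' : X → ℝ≥0∞} {c c' : ℝ≥0∞} (h : UpperIntegralLE ν F c)
    (hF : ∀ t, F' t ≤ F t) (hc : c ≤ c') : UpperIntegralLE ν F' c' := by
  obtain ⟨G, hG, h1, h2⟩ := h
  exact ⟨G, hG, fun t => (hF t).trans (h1 t), h2.trans hc⟩

theorem UpperIntegralLE.add {F F' : X → ℝ≥0∞} {c c' : ℝ≥0∞} (h : UpperIntegralLE ν F c)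
    (h' : UpperIntegralLE ν F' c') : UpperIntegralLE ν (fun t => F t + F' t) (c + c') := by
  obtain ⟨G, hG, h1, h2⟩ := h
  obtain ⟨G', hG', h1', h2'⟩ := h'
  refine ⟨fun t => G t + G' t, hG.add hG', fun t => add_le_add (h1 t) (h1' t), ?_⟩
  rw [lintegral_add_left hG]
  exact add_le_add h2 h2'

theorem UpperIntegralLE.const_mul {F : X → ℝ≥0∞} {c : ℝ≥0∞} (h : UpperIntegralLE ν F c)
    (a : ℝ≥0∞) : UpperIntegralLE ν (fun t => a * F t) (a * c) := by
  obtain ⟨G, hG, h1, h2⟩ := h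
  refine ⟨fun t => a * G t, hG.const_mul a, fun t => mul_le_mul' le_rfl (h1 t), ?_⟩
  rw [lintegral_const_mul _ hG]
  gcongr

/-- Fatou's lemma for upper integrals. -/
theorem UpperIntegralLE.liminf {F : ℕ → X → ℝ≥0∞} {c : ℕ → ℝ≥0∞} {F' : X → ℝ≥0∞} {c' : ℝ≥0∞}
    (h : ∀ n, UpperIntegralLE ν (F n) (c n))
    (hF : ∀ t, F' t ≤ Filter.liminf (fun n => F n t) atTop) (hc : Tendsto c atTop (𝓝 c')) :
    UpperIntegralLE ν F' c' := by
  choose G hG h1 h2 using h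
  refine ⟨fun t => Filter.liminf (fun n => G n t) atTop, Measurable.liminf hG, fun t => ?_, ?_⟩
  · exact (hF t).trans (liminf_le_liminf (Eventually.of_forall fun n => h1 n t))
  · refine (lintegral_liminf_le hG).trans ?_
    rw [← hc.liminf_eq]
    exact liminf_le_liminf (Eventually.of_forall h2)

theorem UpperIntegralLE.of_forall_add {F : X → ℝ≥0∞} {a c : ℝ≥0∞} (ha : a ≠ ∞)
    (h : ∀ ε : ℝ≥0, 0 < ε → UpperIntegralLE ν F (c + a * ε)) : UpperIntegralLE ν F c := by
  have hn : Tendsto (fun n : ℕ => c + a * ((1 / ((n : ℝ≥0) + 1) : ℝ≥0) : ℝ≥0∞)) atTop (𝓝 c) := by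
    have h0 : Tendsto (fun n : ℕ => ((1 / ((n : ℝ≥0) + 1) : ℝ≥0) : ℝ≥0∞)) atTop (𝓝 ((0 : ℝ≥0))) :=
      ENNReal.tendsto_coe.2 tendsto_one_div_add_atTop_nhds_zero_nat
    simpa using tendsto_const_nhds.add (ENNReal.Tendsto.const_mul h0 (Or.inr ha))
  exact UpperIntegralLE.liminf (F := fun _ => F) (fun n => h _ (by positivity)) (fun t => by simp) hn

theorem UpperIntegralLE.ae_lt_top {F : X → ℝ≥0∞} {c : ℝ≥0∞} (h : UpperIntegralLE ν F c)
    (hc : c ≠ ∞) : ∀ᵐ t ∂ν, F t < ∞ := by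
  obtain ⟨G, hG, h1, h2⟩ := h
  filter_upwards [MeasureTheory.ae_lt_top hG (ne_top_of_le_ne_top hc h2)] with t ht
  exact (h1 t).trans_lt ht

theorem UpperIntegralLE.le_of_ae_le {F H : X → ℝ≥0∞} {c : ℝ≥0∞} (h : UpperIntegralLE ν F c)
    (hH : ∀ᵐ t ∂ν, H t ≤ F t) : ∫⁻ t, H t ∂ν ≤ c := by
  obtain ⟨G, hG, h1, h2⟩ := h
  exact (lintegral_mono_ae (hH.mono fun t ht => ht.trans (h1 t))).trans h2

end UpperIntegral

/-! ### The coarea inequality -/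

section Coarea

theorem codimOnePre_ball_le {T : Type*} [MetricSpace T] [MeasurableSpace T] (μ : Measure T) {δ r : ℝ} (x : T) (hr : 0 < r) (hrδ : r ≤ δ) :
    codimOnePre μ δ (ball x r) ≤ μ (ball x r) / ENNReal.ofReal r :=
  (OuterMeasure.boundedBy_le _).trans <|
    iInf_le_of_le x <| iInf_le_of_le r <| iInf_le_of_le hr <| iInf_le_of_le hrδ <|
      iInf_le_of_le rfl le_rfl

variable {T : Type*} [MetricSpace T] [CompactSpace T] [MeasurableSpace T] [BorelSpace T]
  {μ : Measure T}

theorem volume_closedBall_unitAddCircle_le (t : UnitAddCircle) (r : ℝ) :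
    volume (closedBall t r) ≤ ENNReal.ofReal (2 * r) := by
  rw [AddCircle.volume_closedBall]
  exact ENNReal.ofReal_le_ofReal (min_le_right _ _)

/-- Slices of `E` under a map `f` with local Lipschitz constants `c`, where `c μ` is dominated by
`ν` on small balls. -/
theorem upperIntegralLE_codimOnePre {K : ℝ≥0} (hK : BallDoubling μ K) {f : T → UnitAddCircle}
    {E : Set T} {c : T → ℝ≥0} {ν : Measure T} [IsFiniteMeasure ν]
    (h : ∀ x ∈ E, ∀ᶠ r in 𝓝[>] (0 : ℝ),
      (∀ y ∈ ball x (6 * r), dist (f y) (f x) ≤ 6 * r * c x) ∧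
        c x * μ (closedBall x r) ≤ ν (closedBall x r))
    {δ : ℝ} (hδ : 0 < δ) {ε : ℝ≥0∞} (hε : ε ≠ 0) :
    UpperIntegralLE volume (fun t => codimOnePre μ δ (f ⁻¹' {t} ∩ E)) (2 * K ^ 3 * (ν E + ε)) := by
  -- Disjoint balls inside `W` have total `ν`-mass at most `ν E + ε`.
  obtain ⟨W, hEW, hWo, hW⟩ := E.exists_isOpen_le_add ν hε
  have hex : ∀ x ∈ E, ∃ r : ℝ, 0 < r ∧ 6 * r ≤ δ ∧ closedBall x r ⊆ W ∧
      (∀ y ∈ ball x (6 * r), dist (f y) (f x) ≤ 6 * r * c x) ∧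
        c x * μ (closedBall x r) ≤ ν (closedBall x r) := by
    intro x hx
    obtain ⟨η, hη, hηW⟩ := Metric.isOpen_iff.1 hWo x (hEW hx)
    have h1 : ∀ᶠ r in 𝓝[>] (0 : ℝ), r < η :=
      (Iio_mem_nhds hη : Iio η ∈ 𝓝 (0 : ℝ)) |> mem_nhdsWithin_of_mem_nhds
    have h2 : ∀ᶠ r in 𝓝[>] (0 : ℝ), r < δ / 6 :=
      (Iio_mem_nhds (by positivity) : Iio (δ / 6) ∈ 𝓝 (0 : ℝ)) |> mem_nhdsWithin_of_mem_nhds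
    obtain ⟨r, ⟨h3, h4⟩, h5, h6, h7⟩ :=
      ((h x hx).and (h1.and (h2.and self_mem_nhdsWithin))).exists
    exact ⟨r, h7, by linarith, (closedBall_subset_ball h5).trans hηW, h3, h4⟩
  choose! r hr0 hrδ hrW hrf hrν using hex
  -- Disjoint balls whose closed 5-fold enlargements cover `E`; the open 6-fold ones then cover too,
  -- which explains the factor 6.
  obtain ⟨u, huE, hudisj, hucov⟩ :=
    Vitali.exists_disjoint_subfamily_covering_enlargement_closedBall E id r (δ / 6)
      (fun x hx => by linarith [hrδ x hx]) 5 (by norm_num)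
  simp only [id] at hudisj hucov
  have hucount : u.Countable := hudisj.countable_of_nonempty_interior fun x hx =>
    ⟨x, ball_subset_interior_closedBall (mem_ball_self (hr0 x (huE hx)))⟩
  have := hucount.to_subtype
  -- The measurable majorant: a ball contributes its weight only to values `t` near enough to `f x`
  -- for the fibre to meet it.
  let G : u → UnitAddCircle → ℝ≥0∞ := fun x =>
    (closedBall (f x) (6 * r x * c x)).indicator
      fun _ => μ (ball (x : T) (6 * r x)) / ENNReal.ofReal (6 * r x)
  have hGm : ∀ x, Measurable (G x) := fun x => measurable_const.indicator measurableSet_closedBall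
  refine ⟨fun t => ∑' x, G x t, Measurable.tsum hGm, fun t => ?_, ?_⟩
  · have hcov : f ⁻¹' {t} ∩ E ⊆ ⋃ x : u, f ⁻¹' {t} ∩ ball (x : T) (6 * r x) := by
      rintro y ⟨hyt, hyE⟩
      obtain ⟨x, hxu, hx⟩ := hucov y hyE
      have h0 := hr0 x (huE hxu)
      exact mem_iUnion.2 ⟨⟨x, hxu⟩, hyt,
        closedBall_subset_ball (by linarith) (hx (mem_closedBall_self (hr0 y hyE).le))⟩
    refine (measure_mono hcov).trans ((measure_iUnion_le _).trans (ENNReal.tsum_le_tsum fun x => ?_))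
    by_cases ht : t ∈ closedBall (f x) (6 * r x * c x)
    · simp only [G, indicator_of_mem ht]
      exact (measure_mono inter_subset_right).trans
        (codimOnePre_ball_le μ _ (by linarith [hr0 x (huE x.2)]) (hrδ x (huE x.2)))
    · have : f ⁻¹' {t} ∩ ball (x : T) (6 * r x) = ∅ := by
        refine eq_empty_of_forall_notMem fun y ⟨hyt, hyb⟩ => ht ?_
        rw [← (hyt : f y = t), mem_closedBall]
        exact hrf x (huE x.2) y hyb
      simp [this]
  · rw [lintegral_tsum fun x => (hGm x).aemeasurable]
    -- The weight has denominator `6 * r` and the arc has length at most `2 * (6 * r * c)`, so the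
    -- radius cancels; three doublings bring the ball of radius `6 * r` back to radius `r`.
    have hterm : ∀ x : u, ∫⁻ t, G x t ≤ 2 * K ^ 3 * ν (closedBall (x : T) (r x)) := by
      intro x
      have h0 := hr0 x (huE x.2)
      have h6 : ENNReal.ofReal (6 * r x) ≠ 0 := by simpa using h0
      rw [lintegral_indicator_const measurableSet_closedBall]
      calc μ (ball (x : T) (6 * r x)) / ENNReal.ofReal (6 * r x) *
            volume (closedBall (f x) (6 * r x * c x))
          ≤ μ (ball (x : T) (6 * r x)) / ENNReal.ofReal (6 * r x) *
            (ENNReal.ofReal (6 * r x) * (2 * c x)) := by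
            gcongr
            refine (volume_closedBall_unitAddCircle_le _ _).trans (le_of_eq ?_)
            rw [show 2 * (6 * r x * c x) = 6 * r x * (2 * c x) by ring,
              ENNReal.ofReal_mul (by positivity), ENNReal.ofReal_mul (by norm_num)]
            simp
        _ = 2 * c x * μ (ball (x : T) (6 * r x)) := by
            rw [← mul_assoc, ENNReal.div_mul_cancel h6 ENNReal.ofReal_ne_top, mul_comm]
        _ ≤ 2 * c x * (K ^ 3 * μ (closedBall (x : T) (r x))) := by
            gcongr
            refine (measure_mono (ball_subset_ball (by linarith))).trans
              ((hK.eight x h0).trans ?_)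
            gcongr
            exact ball_subset_closedBall
        _ = 2 * K ^ 3 * (c x * μ (closedBall (x : T) (r x))) := by ring
        _ ≤ _ := by gcongr; exact hrν x (huE x.2)
    calc ∑' x : u, ∫⁻ t, G x t ≤ ∑' x : u, 2 * K ^ 3 * ν (closedBall (x : T) (r x)) :=
          ENNReal.tsum_le_tsum hterm
      _ = 2 * K ^ 3 * ν (⋃ x : u, closedBall (x : T) (r x)) := by
          rw [ENNReal.tsum_mul_left, measure_iUnion (hudisj.subtype _ _)
            fun x => measurableSet_closedBall]
      _ ≤ _ := by
          gcongr
          exact (measure_mono (iUnion_subset fun x : u => hrW x (huE x.2))).trans hW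

/-- The bound for `codimOnePre` is uniform in `δ`, so Fatou along `δ = 1 / (n + 1)` carries it to
the supremum. -/
theorem upperIntegralLE_codimOneOuter {K : ℝ≥0} (hK : BallDoubling μ K) {f : T → UnitAddCircle}
    {E : Set T} {c : T → ℝ≥0} {ν : Measure T} [IsFiniteMeasure ν]
    (h : ∀ x ∈ E, ∀ᶠ r in 𝓝[>] (0 : ℝ),
      (∀ y ∈ ball x (6 * r), dist (f y) (f x) ≤ 6 * r * c x) ∧
        c x * μ (closedBall x r) ≤ ν (closedBall x r)) :
    UpperIntegralLE volume (fun t => codimOneOuter μ (f ⁻¹' {t} ∩ E)) (2 * K ^ 3 * ν E) := by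
  refine UpperIntegralLE.of_forall_add (a := 2 * K ^ 3)
    (ENNReal.mul_ne_top (by simp) (by finiteness)) fun ε hε => ?_
  have hδ : ∀ n : ℕ, (0 : ℝ) < 1 / ((n : ℝ) + 1) := fun n => by positivity
  refine UpperIntegralLE.liminf
    (fun n => (upperIntegralLE_codimOnePre hK h (hδ n) (ε := ε) (by simpa using hε.ne')))
    (fun t => ?_) (by rw [mul_add]; exact tendsto_const_nhds)
  rw [codimOneOuter_apply]
  refine iSup₂_le fun δ hδ0 => le_liminf_of_le (by isBoundedDefault) ?_
  have := (tendsto_one_div_add_atTop_nhds_zero_nat (𝕜 := ℝ)).eventually (Iio_mem_nhds hδ0)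
  filter_upwards [this] with n hn
  exact codimOnePre_anti μ (le_of_lt hn) _

end Coarea

/-! ### From slices of sets to integrals over fibres -/

section CoareaInequality

theorem eventually_forall_ball_dist_le {T : Type*} [MetricSpace T]
    {f : T → UnitAddCircle} {x : T} {R c : ℝ} (hR : 0 < R)
    (hc : 0 ≤ c) (h : ∀ y, dist y x < R → dist (f y) (f x) ≤ dist y x * c) :
    ∀ᶠ r in 𝓝[>] (0 : ℝ), ∀ y ∈ ball x (6 * r), dist (f y) (f x) ≤ 6 * r * c := by
  have h1 : ∀ᶠ r in 𝓝[>] (0 : ℝ), r < R / 6 :=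
    mem_nhdsWithin_of_mem_nhds (Iio_mem_nhds (by positivity))
  filter_upwards [h1] with r hr y hy
  have hy := mem_ball.1 hy
  exact (h y (by linarith)).trans (by gcongr)

variable {T : Type*} [MetricSpace T] [CompactSpace T] [MeasurableSpace T] [BorelSpace T]
  {μ : Measure T} [IsFiniteMeasure μ]

/-- The constant of the coarea inequality. -/
def coareaConst (K : ℝ≥0) (CP : ℝ) : ℝ≥0 := 2 * K ^ 3 * (16 * K ^ 3 * CP.toNNReal)

/-- The global Lipschitz constant suffices as local constant, with `ν = L • μ`. This discards the
points that are not Lebesgue points. -/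
theorem upperIntegralLE_codimOneOuter_of_null {K : ℝ≥0} (hK : BallDoubling μ K)
    {f : T → UnitAddCircle} {L : ℝ≥0} (hf : LipschitzWith L f) {N : Set T} (hN : μ N = 0) :
    UpperIntegralLE volume (fun t => codimOneOuter μ (f ⁻¹' {t} ∩ N)) 0 := by
  refine (upperIntegralLE_codimOneOuter hK (f := f) (E := N) (c := fun _ => L) (ν := L • μ)
    fun x _ => ?_).mono (fun _ => le_rfl) (by simp [hN])
  filter_upwards [eventually_forall_ball_dist_le one_pos L.2 fun y _ => by
    rw [mul_comm]; exact hf.dist_le_mul y x] with r hr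
  exact ⟨hr, by simp⟩

theorem upperIntegralLE_codimOneOuter_lebesguePoints {CP lam : ℝ} (hCP : 0 < CP) (hlam : 1 ≤ lam)
    (hP : SupportsWeakPoincare μ CP lam) {K : ℝ≥0} (hK : BallDoubling μ K) (hK1 : 1 ≤ K)
    {f : T → UnitAddCircle} {L : ℝ≥0} (hf : LipschitzWith L f) {g : T → ℝ≥0∞}
    (hg : IsUpperGradient f g) (hint : ∫⁻ x, g x ∂μ ≠ ∞) {A : Set T} (hA : MeasurableSet A) :
    UpperIntegralLE volume
      (fun t => codimOneOuter μ (f ⁻¹' {t} ∩ (A ∩ {x | IsLebesguePoint μ g x})))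
      (coareaConst K CP * ∫⁻ x in A, g x ∂μ) := by
  set κ : ℝ≥0 := 16 * K ^ 3 * CP.toNNReal with hκ
  refine UpperIntegralLE.of_forall_add (a := 2 * K ^ 3 * ((2 * κ + 1) * μ univ))
    (by finiteness) fun ε hε => ?_
  have := isFiniteMeasure_withDensity hint
  -- Here `c` is the pointwise bound on `f`. Replacing `g x * μ B` by the integral of `g` over `B`
  -- costs `κ * ε * μ B`, and `c` itself carries `(κ + 1) * ε`; hence the term `(2 * κ + 1) * ε` in
  -- `ν`.
  refine (upperIntegralLE_codimOneOuter hK (f := f) (E := A ∩ {x | IsLebesguePoint μ g x})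
    (c := fun x => κ * ((g x).toNNReal + ε) + ε)
    (ν := κ • μ.withDensity g + ((2 * κ + 1) * ε) • μ) fun x hx => ?_).mono (fun _ => le_rfl) ?_
  · obtain ⟨R, hR, hd⟩ := hP.dist_le hCP hlam hK hK1 hf hg hx.2 hε
    obtain ⟨R', hR', hL⟩ := hx.2.2 0 ε hε
    have hcoe : (16 * K ^ 3 * CP * ((g x).toNNReal + ε) + ε : ℝ) =
        ((κ * ((g x).toNNReal + ε) + ε : ℝ≥0) : ℝ) := by
      rw [hκ]; push_cast; rw [Real.coe_toNNReal _ hCP.le]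
    rw [hcoe] at hd
    have h1 : ∀ᶠ r in 𝓝[>] (0 : ℝ), r < R' := mem_nhdsWithin_of_mem_nhds (Iio_mem_nhds hR')
    filter_upwards [eventually_forall_ball_dist_le hR (NNReal.coe_nonneg _) hd, h1,
      self_mem_nhdsWithin] with r hr hrR' hr0
    refine ⟨hr, ?_⟩
    have h2 := (hL x r hr0 hrR' (by simp)).2
    have h3 : (((g x).toNNReal : ℝ≥0) : ℝ≥0∞) = g x := ENNReal.coe_toNNReal hx.2.1
    simp only [Measure.coe_add, Measure.coe_nnreal_smul_apply, Pi.add_apply,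
      withDensity_apply _ measurableSet_closedBall]
    push_cast
    rw [h3]
    calc (κ * (g x + ε) + ε) * μ (closedBall x r)
        = κ * (g x * μ (closedBall x r)) + (κ + 1) * ε * μ (closedBall x r) := by ring
      _ ≤ κ * (∫⁻ y in closedBall x r, g y ∂μ + ε * μ (closedBall x r)) +
          (κ + 1) * ε * μ (closedBall x r) := by gcongr
      _ = _ := by ring
  · simp only [Measure.coe_add, Measure.coe_nnreal_smul_apply, Pi.add_apply]
    have h1 : μ.withDensity g (A ∩ {x | IsLebesguePoint μ g x}) ≤ ∫⁻ x in A, g x ∂μ := by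
      rw [← withDensity_apply _ hA]; exact measure_mono inter_subset_left
    have h2 : μ (A ∩ {x | IsLebesguePoint μ g x}) ≤ μ univ := measure_mono (subset_univ _)
    rw [coareaConst, ← hκ]
    push_cast
    calc _ ≤ 2 * (K : ℝ≥0∞) ^ 3 * (κ * ∫⁻ x in A, g x ∂μ + (2 * κ + 1) * ε * μ univ) := by gcongr
      _ = _ := by ring

theorem upperIntegralLE_codimOneOuter_inter {CP lam : ℝ} (hCP : 0 < CP) (hlam : 1 ≤ lam)
    (hP : SupportsWeakPoincare μ CP lam) {K : ℝ≥0} (hK : BallDoubling μ K) (hK1 : 1 ≤ K)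
    {f : T → UnitAddCircle} {L : ℝ≥0} (hf : LipschitzWith L f) {g : T → ℝ≥0∞}
    (hg : IsUpperGradient f g) (hint : ∫⁻ x, g x ∂μ ≠ ∞) {A : Set T} (hA : MeasurableSet A) :
    UpperIntegralLE volume (fun t => codimOneOuter μ (f ⁻¹' {t} ∩ A))
      (coareaConst K CP * ∫⁻ x in A, g x ∂μ) := by
  have : SecondCountableTopology T := UniformSpace.secondCountable_of_separable T
  have hae := ae_isLebesguePoint hK (fun x r hr => (hP.1 x r hr).1) hg.1 hint
  have h1 := upperIntegralLE_codimOneOuter_lebesguePoints hCP hlam hP hK hK1 hf hg hint hA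
  have h2 := upperIntegralLE_codimOneOuter_of_null hK hf (ae_iff.1 hae)
  refine (h1.add h2).mono (fun t => ?_) (by simp)
  refine (measure_mono ?_).trans (measure_union_le _ _)
  rintro x ⟨hxt, hxA⟩
  by_cases hx : IsLebesguePoint μ g x
  · exact Or.inl ⟨hxt, hxA, hx⟩
  · exact Or.inr ⟨hxt, hx⟩

/-- The coarea inequality for Lipschitz maps to the circle and integrable upper gradients. -/
theorem coarea_inequality {CP lam : ℝ} (hCP : 0 < CP) (hlam : 1 ≤ lam)
    (hP : SupportsWeakPoincare μ CP lam) {K : ℝ≥0} (hK : BallDoubling μ K) (hK1 : 1 ≤ K)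
    {f : T → UnitAddCircle} {L : ℝ≥0} (hf : LipschitzWith L f) {g : T → ℝ≥0∞}
    (hg : IsUpperGradient f g) (hint : ∫⁻ x, g x ∂μ ≠ ∞) {h : T → ℝ≥0∞} (hh : Measurable h) :
    UpperIntegralLE volume (fun t => ∫⁻ x, h x ∂(codimOneHausdorff μ).restrict (f ⁻¹' {t}))
      (coareaConst K CP * ∫⁻ x, h x * g x ∂μ) := by
  have hgm := hg.1
  refine Measurable.ennreal_induction (motive := fun h => UpperIntegralLE volume
    (fun t => ∫⁻ x, h x ∂(codimOneHausdorff μ).restrict (f ⁻¹' {t}))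
    (coareaConst K CP * ∫⁻ x, h x * g x ∂μ)) ?_ ?_ ?_ hh
  · intro c A hA
    refine ((upperIntegralLE_codimOneOuter_inter hCP hlam hP hK hK1 hf hg hint hA).const_mul
      c).mono (fun t => ?_) (le_of_eq ?_)
    · have hS : MeasurableSet (f ⁻¹' {t}) := (isClosed_singleton.preimage hf.continuous).measurableSet
      -- Fibres are closed, so on these Borel sets the measure `ℋ` equals the outer measure.
      rw [lintegral_indicator_const hA, Measure.restrict_apply hA, inter_comm A, codimOneHausdorff,
        toMeasure_apply _ _ (hS.inter hA)]
    · rw [mul_left_comm, ← lintegral_const_mul _ hgm, ← lintegral_indicator hA]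
      congr 2 with x
      by_cases hx : x ∈ A <;> simp [hx]
  · intro f₁ f₂ _ hf₁ hf₂ h₁ h₂
    refine (h₁.add h₂).mono (fun t => ?_) (le_of_eq ?_)
    · simp only [Pi.add_apply]; rw [lintegral_add_left hf₁]
    · simp only [Pi.add_apply, add_mul]
      rw [lintegral_add_left (f := fun x => f₁ x * g x) (hf₁.mul hgm), mul_add]
  · intro F hF hmono hFi
    refine UpperIntegralLE.liminf hFi (fun t => ?_) ?_
    · rw [lintegral_iSup hF hmono]
      have : Monotone fun n => ∫⁻ x, F n x ∂(codimOneHausdorff μ).restrict (f ⁻¹' {t}) :=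
        fun m n hmn => lintegral_mono (hmono hmn)
      rw [(tendsto_atTop_iSup this).liminf_eq]
    · refine ENNReal.Tendsto.const_mul ?_ (Or.inr ENNReal.coe_ne_top)
      simp only [ENNReal.iSup_mul]
      have hmul : Monotone fun n x => F n x * g x :=
        fun m n hmn x => mul_le_mul' (hmono hmn x) le_rfl
      rw [lintegral_iSup (f := fun n x => F n x * g x) (fun n => (hF n).mul hgm) hmul]
      exact tendsto_atTop_iSup fun m n hmn => lintegral_mono (hmul hmn)

end CoareaInequality

/-! ### From weak upper gradients to upper gradients -/

section Weak

variable {T : Type*} [MetricSpace T] [MeasurableSpace T] {μ : Measure T}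

theorem lineIntegral_mono {T : Type*} [MetricSpace T] (γ : CompactPath T) {ρ τ : T → ℝ≥0∞} (h : ρ ≤ τ) :
    γ.lineIntegral ρ ≤ γ.lineIntegral τ :=
  lintegral_mono fun _ => h _

/-- Weak upper gradients of circle-valued maps are limits of upper gradients. -/
theorem IsWeakUpperGradient.exists_isUpperGradient {p : ℝ} {f : T → UnitAddCircle}
    {ρ : T → ℝ≥0∞} (h : IsWeakUpperGradient μ p f ρ) {ε : ℝ≥0∞} (hε : 0 < ε) :
    ∃ τ : T → ℝ≥0∞, Measurable τ ∧ ∫⁻ x, τ x ^ p ∂μ < ε ∧ IsUpperGradient f (ρ + τ) := by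
  obtain ⟨hρ, hmod⟩ := h
  rw [← hmod] at hε
  simp only [pathModulus, iInf_lt_iff] at hε
  obtain ⟨τ, hτ, hadm, hlt⟩ := hε
  refine ⟨τ, hτ, hlt, hρ.add hτ, fun γ hγ => ?_⟩
  by_cases hin : UpperGradientIneq f ρ γ
  · exact hin.trans (lineIntegral_mono γ fun x => le_self_add)
  -- On exceptional paths `τ` has line integral at least 1, while points of the circle are at
  -- distance at most 1/2.
  · refine le_trans ?_ ((hadm γ ⟨hγ, hin⟩ hγ).trans
      (lineIntegral_mono γ fun x => le_add_self))
    rw [edist_dist, dist_eq_norm, ← ENNReal.ofReal_one]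
    refine ENNReal.ofReal_le_ofReal ((AddCircle.norm_le_half_period 1 one_ne_zero).trans ?_)
    norm_num

end Weak

/-! ### Translates of degree one maps -/

section Degree

variable {T : Type*} [TopologicalSpace T]

/-- A rotation carries homotopies to homotopies and `circleLoop` to `circleLoop`. This makes every
fibre of a degree 1 map the zero level set of a degree 1 map. -/
theorem HasDegree.sub_const {x₀ : T} {α : Path x₀ x₀} {f : C(T, UnitAddCircle)} {n : ℤ}
    (h : HasDegree α f n) (t : UnitAddCircle) :
    HasDegree α (f - ContinuousMap.const T t) n := by
  intro x γ hγ
  have hc : Continuous fun s : UnitAddCircle => s - t := continuous_id.sub continuous_const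
  have h1 := (h x γ hγ).map ⟨fun s : UnitAddCircle => s - t, hc⟩
  have h2 : (circleLoop (f x) n).map hc = circleLoop ((f - ContinuousMap.const T t) x) n := by
    ext s
    simp [circleLoop, sub_add_eq_add_sub]
  rw [← h2]
  exact h1

end Degree

/-! ### The duality estimate -/

section Duality

theorem lintegral_ne_top_of_rpow {T : Type*} [MeasurableSpace T] {μ : Measure T}
    [IsFiniteMeasure μ] {p : ℝ} (hp : 1 ≤ p) {g : T → ℝ≥0∞}
    (h : ∫⁻ x, g x ^ p ∂μ ≠ ∞) : ∫⁻ x, g x ∂μ ≠ ∞ := by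
  refine ne_top_of_le_ne_top (b := ∫⁻ x, (1 + g x ^ p) ∂μ) ?_ (lintegral_mono fun x => ?_)
  · rw [lintegral_add_left measurable_const]
    simp [h]
  · rcases le_total (g x) 1 with h1 | h1
    · exact h1.trans le_self_add
    · exact (ENNReal.le_rpow_self_of_one_le h1 hp).trans le_add_self

variable {T : Type*} [MetricSpace T] [CompactSpace T] [MeasurableSpace T] [BorelSpace T]
  {μ : Measure T} [IsFiniteMeasure μ]

/-- Coarea is used twice: with the constant 1, so that almost every fibre has finite `ℋ`-measure and
is tested by `h`, and with `h`, to integrate the resulting inequality over the circle. -/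
theorem one_le_coareaConst_mul_lintegral {CP lam : ℝ} (hCP : 0 < CP) (hlam : 1 ≤ lam)
    (hP : SupportsWeakPoincare μ CP lam) {K : ℝ≥0} (hK : BallDoubling μ K) (hK1 : 1 ≤ K)
    {x₀ : T} {α : Path x₀ x₀}
    {f : C(T, UnitAddCircle)} {L : ℝ≥0} (hf : LipschitzWith L f) (hdeg : HasDegree α f 1)
    {g : T → ℝ≥0∞} (hg : IsUpperGradient f g) (hint : ∫⁻ x, g x ∂μ ≠ ∞)
    {h : T → ℝ≥0∞} (hh : Measurable h)
    (hadm : ∀ S ∈ levelSets μ α, 1 ≤ ∫⁻ x, h x ∂(codimOneHausdorff μ).restrict S) :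
    1 ≤ coareaConst K CP * ∫⁻ x, h x * g x ∂μ := by
  have h1 := coarea_inequality hCP hlam hP hK hK1 hf hg hint hh
  have h2 := coarea_inequality hCP hlam hP hK hK1 hf hg hint (h := fun _ => 1) measurable_const
  have h3 := h2.ae_lt_top (by simpa using ENNReal.mul_ne_top ENNReal.coe_ne_top hint)
  have h4 := h1.le_of_ae_le (H := fun _ => 1) (h3.mono fun t ht => hadm _
    ⟨f - ContinuousMap.const T t, hdeg.sub_const t, ?_, by simpa using ht⟩)
  · simpa using h4
  · ext x
    simp [sub_eq_zero]

theorem one_le_coareaConst_mul_rpow_of_isUpperGradient {CP lam : ℝ} (hCP : 0 < CP)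
    (hlam : 1 ≤ lam) (hP : SupportsWeakPoincare μ CP lam) {K : ℝ≥0} (hK : BallDoubling μ K)
    (hK1 : 1 ≤ K) {x₀ : T} {α : Path x₀ x₀}
    {f : C(T, UnitAddCircle)} {L : ℝ≥0} (hf : LipschitzWith L f) (hdeg : HasDegree α f 1)
    {p q : ℝ} (hpq : p.HolderConjugate q)
    {g : T → ℝ≥0∞} (hg : IsUpperGradient f g) (hint : ∫⁻ x, g x ^ p ∂μ ≠ ∞)
    {h : T → ℝ≥0∞} (hh : Measurable h)
    (hadm : ∀ S ∈ levelSets μ α, 1 ≤ ∫⁻ x, h x ∂(codimOneHausdorff μ).restrict S) :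
    1 ≤ coareaConst K CP * ((∫⁻ x, g x ^ p ∂μ) ^ (1 / p) * (∫⁻ x, h x ^ q ∂μ) ^ (1 / q)) := by
  refine (one_le_coareaConst_mul_lintegral hCP hlam hP hK hK1 hf hdeg hg
    (lintegral_ne_top_of_rpow hpq.lt.le hint) hh hadm).trans ?_
  gcongr
  simp_rw [mul_comm (h _)]
  exact ENNReal.lintegral_mul_le_Lp_mul_Lq μ hpq hg.1.aemeasurable hh.aemeasurable

/-- A weak upper gradient becomes an upper gradient after adding a `τ` of `L^p` norm below `ε`. By
Minkowski the norm grows by at most `ε`, and finiteness of the norm of `h` lets `ε` tend to `0`. -/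
theorem one_le_coareaConst_mul_rpow {CP lam : ℝ} (hCP : 0 < CP)
    (hlam : 1 ≤ lam) (hP : SupportsWeakPoincare μ CP lam) {K : ℝ≥0} (hK : BallDoubling μ K)
    (hK1 : 1 ≤ K) {x₀ : T} {α : Path x₀ x₀}
    {f : C(T, UnitAddCircle)} {L : ℝ≥0} (hf : LipschitzWith L f) (hdeg : HasDegree α f 1)
    {p q : ℝ} (hpq : p.HolderConjugate q)
    {g : T → ℝ≥0∞} (hg : IsWeakUpperGradient μ p f g) (hint : ∫⁻ x, g x ^ p ∂μ ≠ ∞)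
    {h : T → ℝ≥0∞} (hh : Measurable h) (hfin : ∫⁻ x, h x ^ q ∂μ ≠ ∞)
    (hadm : ∀ S ∈ levelSets μ α, 1 ≤ ∫⁻ x, h x ∂(codimOneHausdorff μ).restrict S) :
    1 ≤ coareaConst K CP * ((∫⁻ x, g x ^ p ∂μ) ^ (1 / p) * (∫⁻ x, h x ^ q ∂μ) ^ (1 / q)) := by
  have hp0 : 0 < p := hpq.pos
  set H := (∫⁻ x, h x ^ q ∂μ) ^ (1 / q) with hH
  set N := (∫⁻ x, g x ^ p ∂μ) ^ (1 / p) with hN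
  have hHfin : H ≠ ∞ := ENNReal.rpow_ne_top_of_nonneg hpq.symm.one_div_pos.le hfin
  have key : ∀ ε : ℝ≥0, 0 < ε → 1 ≤ coareaConst K CP * ((N + ε) * H) := by
    intro ε hε
    obtain ⟨τ, hτ, hlt, hup⟩ := hg.exists_isUpperGradient
      (ε := (ε : ℝ≥0∞) ^ p) (ENNReal.rpow_pos (by simpa using hε) ENNReal.coe_ne_top)
    have hmink : (∫⁻ x, (g + τ) x ^ p ∂μ) ^ (1 / p) ≤ N + ε := by
      refine (ENNReal.lintegral_Lp_add_le hg.1.aemeasurable hτ.aemeasurable hpq.lt.le).trans ?_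
      gcongr
      calc (∫⁻ x, τ x ^ p ∂μ) ^ (1 / p) ≤ ((ε : ℝ≥0∞) ^ p) ^ (1 / p) := by gcongr
        _ = ε := by rw [← ENNReal.rpow_mul, mul_one_div_cancel hp0.ne', ENNReal.rpow_one]
    have hNfin : N ≠ ∞ := ENNReal.rpow_ne_top_of_nonneg hpq.one_div_pos.le hint
    refine (one_le_coareaConst_mul_rpow_of_isUpperGradient hCP hlam hP hK hK1 hf hdeg hpq hup
      (fun htop => ?_) hh hadm).trans (by gcongr)
    rw [htop, ENNReal.top_rpow_of_pos hpq.one_div_pos] at hmink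
    exact (ENNReal.add_ne_top.2 ⟨hNfin, ENNReal.coe_ne_top⟩) (top_le_iff.1 hmink)
  have hn : Tendsto (fun n : ℕ => coareaConst K CP *
      ((N + ((1 / ((n : ℝ≥0) + 1) : ℝ≥0) : ℝ≥0∞)) * H)) atTop
      (𝓝 (coareaConst K CP * (N * H))) := by
    have h0 : Tendsto (fun n : ℕ => ((1 / ((n : ℝ≥0) + 1) : ℝ≥0) : ℝ≥0∞)) atTop (𝓝 ((0 : ℝ≥0))) :=
      ENNReal.tendsto_coe.2 tendsto_one_div_add_atTop_nhds_zero_nat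
    have h1 := (tendsto_const_nhds (x := N)).add h0
    rw [ENNReal.coe_zero, add_zero] at h1
    exact ENNReal.Tendsto.const_mul (ENNReal.Tendsto.mul_const h1 (Or.inr hHfin))
      (Or.inr ENNReal.coe_ne_top)
  exact ge_of_tendsto' hn fun n => key _ (by positivity)

/-- Isolates `y` as bounded below by a constant, the form in which an infimum can be taken. -/
theorem one_le_mul_rpow_iff {c y : ℝ≥0∞} {s : ℝ} (hs : 0 < s) (h0 : c ≠ 0) (hc : c ≠ ∞) :
    1 ≤ c * y ^ (1 / s) ↔ c⁻¹ ^ s ≤ y := by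
  rw [one_div, ENNReal.le_rpow_inv_iff hs |>.symm,
    ENNReal.inv_le_iff_le_mul (fun _ => h0) (fun h => absurd h hc)]

theorem one_le_coareaConst_mul_surfaceModulus {CP lam : ℝ} (hCP : 0 < CP)
    (hlam : 1 ≤ lam) (hP : SupportsWeakPoincare μ CP lam) {K : ℝ≥0} (hK : BallDoubling μ K)
    (hK1 : 1 ≤ K) {x₀ : T} {α : Path x₀ x₀}
    {f : C(T, UnitAddCircle)} {L : ℝ≥0} (hf : LipschitzWith L f) (hdeg : HasDegree α f 1)
    {p q : ℝ} (hpq : p.HolderConjugate q)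
    {g : T → ℝ≥0∞} (hg : IsWeakUpperGradient μ p f g) (hint : ∫⁻ x, g x ^ p ∂μ ≠ ∞)
    (hmod : surfaceModulus μ α q ≠ ∞) :
    1 ≤ coareaConst K CP * (∫⁻ x, g x ^ p ∂μ) ^ (1 / p) * surfaceModulus μ α q ^ (1 / q) := by
  have hadm : ∀ h : T → ℝ≥0∞,
      (∀ ν ∈ {ν | ∃ S ∈ levelSets μ α, ν = (codimOneHausdorff μ).restrict S}, 1 ≤ ∫⁻ x, h x ∂ν) →
      ∀ S ∈ levelSets μ α, 1 ≤ ∫⁻ x, h x ∂(codimOneHausdorff μ).restrict S :=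
    fun h hh S hS => hh _ ⟨S, hS, rfl⟩
  have key : ∀ h : T → ℝ≥0∞, Measurable h →
      (∀ ν ∈ {ν | ∃ S ∈ levelSets μ α, ν = (codimOneHausdorff μ).restrict S}, 1 ≤ ∫⁻ x, h x ∂ν) →
      ∫⁻ x, h x ^ q ∂μ ≠ ∞ →
      1 ≤ coareaConst K CP * (∫⁻ x, g x ^ p ∂μ) ^ (1 / p) * (∫⁻ x, h x ^ q ∂μ) ^ (1 / q) := by
    intro h hh hν hfin
    rw [mul_assoc]
    exact one_le_coareaConst_mul_rpow hCP hlam hP hK hK1 hf hdeg hpq hg hint hh hfin (hadm h hν)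
  have hc : coareaConst K CP * (∫⁻ x, g x ^ p ∂μ) ^ (1 / p) ≠ ∞ :=
    ENNReal.mul_ne_top ENNReal.coe_ne_top
      (ENNReal.rpow_ne_top_of_nonneg hpq.one_div_pos.le hint)
  -- Finite modulus provides an admissible `h` with finite integral, for which a zero factor would
  -- give `1 ≤ 0`.
  have hc0 : coareaConst K CP * (∫⁻ x, g x ^ p ∂μ) ^ (1 / p) ≠ 0 := by
    intro h0
    have hlt := hmod.lt_top
    simp only [surfaceModulus, modulus, iInf_lt_iff] at hlt
    obtain ⟨h, hh, hν, hfin⟩ := hlt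
    have := key h hh hν hfin.ne
    rw [h0, zero_mul] at this
    simp at this
  rw [one_le_mul_rpow_iff hpq.symm.pos hc0 hc]
  refine le_iInf fun h => le_iInf fun hh => le_iInf fun hν => ?_
  by_cases hfin : ∫⁻ x, h x ^ q ∂μ = ∞
  · rw [hfin]; exact le_top
  · exact (one_le_mul_rpow_iff hpq.symm.pos hc0 hc).1 (key h hh hν hfin)

theorem LipschitzWith.isUpperGradient_const {T Y : Type*} [MetricSpace T] [MeasurableSpace T]
    [PseudoMetricSpace Y] {f : T → Y} {L : ℝ≥0} (hf : LipschitzWith L f) :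
    IsUpperGradient f fun _ => (L : ℝ≥0∞) := by
  refine ⟨measurable_const, fun γ hγ => ?_⟩
  have h1 : γ.lineIntegral (fun _ => (L : ℝ≥0∞)) = L * γ.length := by
    simp [CompactPath.lineIntegral, ENNReal.ofReal_toReal hγ]
  rw [UpperGradientIneq, h1]
  refine (hf _ _).trans ?_
  gcongr
  exact eVariationOn.edist_le _ (left_mem_Icc.2 γ.le) (right_mem_Icc.2 γ.le)

theorem IsUpperGradient.isWeakUpperGradient {T Y : Type*} [MetricSpace T] [MeasurableSpace T]
    [PseudoMetricSpace Y] {μ : Measure T} {f : T → Y} {g : T → ℝ≥0∞} (hg : IsUpperGradient f g)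
    {p : ℝ} (hp : 0 < p) : IsWeakUpperGradient μ p f g := by
  refine ⟨hg.1, le_antisymm ?_ zero_le⟩
  refine iInf_le_of_le (fun _ => 0) <| iInf_le_of_le measurable_const <|
    iInf_le_of_le (fun γ hγ => absurd (hg.2 γ hγ.1) hγ.2) ?_
  simp [hp]

theorem one_le_coareaConst_mul_capacity_mul_surfaceModulus {CP lam : ℝ} (hCP : 0 < CP)
    (hlam : 1 ≤ lam) (hP : SupportsWeakPoincare μ CP lam) {K : ℝ≥0} (hK : BallDoubling μ K)
    (hK1 : 1 ≤ K) {x₀ : T} {α : Path x₀ x₀}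
    (hex : ∃ φ : C(T, UnitAddCircle), (∃ L : ℝ≥0, LipschitzWith L φ) ∧ HasDegree α φ 1)
    {p q : ℝ} (hpq : p.HolderConjugate q) (hmod : surfaceModulus μ α q ≠ ∞) :
    1 ≤ coareaConst K CP * surfaceModulus μ α q ^ (1 / q) * capacity μ α p ^ (1 / p) := by
  have hc : coareaConst K CP * surfaceModulus μ α q ^ (1 / q) ≠ ∞ :=
    ENNReal.mul_ne_top ENNReal.coe_ne_top
      (ENNReal.rpow_ne_top_of_nonneg hpq.symm.one_div_pos.le hmod)
  -- The given Lipschitz degree 1 map, with its Lipschitz constant as upper gradient, has finite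
  -- energy and so forces the modulus to be positive.
  have hc0 : coareaConst K CP * surfaceModulus μ α q ^ (1 / q) ≠ 0 := by
    intro h0
    obtain ⟨φ, ⟨L, hL⟩, hdeg⟩ := hex
    have hint : ∫⁻ _ : T, (L : ℝ≥0∞) ^ p ∂μ ≠ ∞ := by
      rw [lintegral_const]
      exact ENNReal.mul_ne_top (ENNReal.rpow_ne_top_of_nonneg hpq.nonneg ENNReal.coe_ne_top)
        (measure_ne_top _ _)
    have := one_le_coareaConst_mul_surfaceModulus hCP hlam hP hK hK1 hL hdeg hpq
      ((LipschitzWith.isUpperGradient_const hL).isWeakUpperGradient hpq.pos) hint hmod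
    rw [mul_right_comm, h0, zero_mul] at this
    simp at this
  rw [one_le_mul_rpow_iff hpq.pos hc0 hc]
  refine le_iInf fun f => le_iInf fun ⟨L, hL⟩ => le_iInf fun hdeg => le_iInf fun ρ =>
    le_iInf fun hρ => ?_
  rw [← one_le_mul_rpow_iff hpq.pos hc0 hc, mul_right_comm]
  exact one_le_coareaConst_mul_surfaceModulus hCP hlam hP hK hK1 hL hdeg hpq hρ.1 hρ.2.1.ne hmod

end Duality

end ToroidalDuality

end

/-! ### The theorem, with the cases of infinite modulus and zero capacity -/

theorem mainTheorem3 (Cμ CP lam : ℝ) (hCμ : 1 < Cμ) (hCP : 0 < CP) (hlam : 1 ≤ lam) :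
    ∃ C : ℝ, 0 < C ∧
      ∀ (T : Type*) [MetricSpace T] [CompactSpace T] [MeasurableSpace T] [BorelSpace T]
        (μ : Measure T),
        IsDoubling μ Cμ →
        SupportsWeakPoincare μ CP lam →
        SemilocallySimplyConnected T →
        (∀ x : T, Nonempty (FundamentalGroup T x ≃* Multiplicative ℤ)) →
        ∀ (x₀ : T) (α : Path x₀ x₀), IsGeneratingLoop α →
        (∃ φ : C(T, UnitAddCircle), (∃ K : ℝ≥0, LipschitzWith K φ) ∧ HasDegree α φ 1) →
        ∀ p : ℝ, 1 < p →
          (0 < capacity μ α p →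
            ENNReal.ofReal (1 / C) ≤
              capacity μ α p ^ (1 / p) *
                surfaceModulus μ α (p / (p - 1)) ^ (1 / (p / (p - 1)))) ∧
          (capacity μ α p = 0 → surfaceModulus μ α (p / (p - 1)) = ∞) := by
  have hK1 : 1 ≤ Cμ.toNNReal := by
    rw [← NNReal.coe_le_coe, Real.coe_toNNReal _ (by linarith)]
    exact_mod_cast hCμ.le
  have hC : 0 < coareaConst Cμ.toNNReal CP := by
    have h1 : 0 < Cμ.toNNReal := by positivity
    have h2 : 0 < CP.toNNReal := by positivity
    unfold coareaConst
    positivity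
  refine ⟨coareaConst Cμ.toNNReal CP, hC, ?_⟩
  intro T _ _ _ _ μ hD hP _ _ x₀ α _ hex p hp
  have hpq : p.HolderConjugate (p / (p - 1)) := Real.HolderConjugate.conjExponent hp
  have hK := hD.ballDoubling hCμ
  have : IsFiniteMeasure μ := by
    refine ⟨?_⟩
    obtain ⟨r, hr, hsub⟩ := (isCompact_univ (X := T)).isBounded.subset_ball_lt 0 x₀
    exact (measure_mono hsub).trans_lt (hP.1 x₀ r hr).2
  have key := fun hmod => one_le_coareaConst_mul_capacity_mul_surfaceModulus hCP hlam hP hK hK1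
    hex hpq hmod
  have hC0 : (coareaConst Cμ.toNNReal CP : ℝ≥0∞) ≠ 0 := by simpa using hC.ne'
  refine ⟨fun hcap => ?_, fun hcap => ?_⟩
  -- If the modulus is infinite, positive capacity rules out the product `0 * ∞ = 0`, so the right
  -- side is `∞`.
  · by_cases hmod : surfaceModulus μ α (p / (p - 1)) = ∞
    · rw [hmod, ENNReal.top_rpow_of_pos hpq.symm.one_div_pos, ENNReal.mul_top]
      · exact le_top
      · exact (ENNReal.rpow_pos_of_nonneg hcap hpq.one_div_pos.le).ne'
    · have h1 := key hmod
      rw [mul_assoc, mul_comm (surfaceModulus _ _ _ ^ _)] at h1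
      rw [one_div, ENNReal.ofReal_inv_of_pos (by exact_mod_cast hC), ENNReal.ofReal_coe_nnreal]
      exact (ENNReal.inv_le_iff_le_mul (fun _ => hC0) (fun h => absurd h ENNReal.coe_ne_top)).2 h1
  -- Zero capacity with finite modulus would turn the duality estimate into `1 ≤ 0`.
  · by_contra hmod
    have h1 := key hmod
    rw [hcap, ENNReal.zero_rpow_of_pos hpq.one_div_pos, mul_zero] at h1
    simp at h1
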